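/- Let $G$ be a discrete amenable group. Let $T$ be a measure-preserving action of $G$ on a probability space $(X,\mu)$, and let $B$ be a Bernoulli action of $G$ on a probability space $(Y,\nu)$, i.e. a measure-preserving action that is isomorphic modulo null sets to the shift action $(g\cdot\omega)(h)=\omega(hg)$ on a product space $(K,\kappa)^G$, where $\kappa$ is a probability measure on a standard Borel space $K$. Let $T\times B$ be the product action $g\cdot(x,y)=(T_g x,B_g y)$ on $(X\times Y,\mu\times\nu)$, and let $\mathcal A$ be the $\sigma$-algebra on $X\times Y$ generated by the coordinate projection to $Y$. For a measure-preserving action $S$ of $G$ on a probability space, a finite measurable partition $P$ and an $S$-invariant sub-$\sigma$-algebra $\mathcal C$, put $$h(S,P\mid\mathcal C)=\lim_F \frac1{|F|}\,H\Big(\bigvee_{g\in F}S_g^{-1}P\;\Big|\;\mathcal C\Big),\qquad h(S,P)=\lim_F \frac1{|F|}\,H\Big(\bigvee_{g\in F}S_g^{-1}P\Big),$$ where $H$ denotes (conditional) Shannon entropy and the limits are taken along Følner sets $F\subseteq G$ (nonempty finite sets with $|gF\,\triangle\, F|/|F|\to 0$ for every $g\in G$). The action $S$ has completely positive entropy (is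 cpe) if $h(S,P)>0$ for every finite measurable partition $P$ that is not trivial modulo null sets, and $S$ is cpe relative to $\mathcal C$ if $h(S,P\mid\mathcal C)>0$ for every finite measurable partition $P$ that is not $\mathcal C$-measurable modulo null sets. If $T\times B$ is cpe relative to $\mathcal A$, then $T$ is cpe. -/

import Mathlib

open MeasureTheory Filter Topology
open scoped Pointwise symmDiff

noncomputable section

namespace AmenableEntropy

section Amenable

variable (G : Type*) [Group G]

open scoped Classical in
/-- The nonempty finite set `F ⊆ G` is `(K, ε)`-invariant: `|gF ∆ F| ≤ ε |F|` for all `g ∈ K`. -/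
def IsFoelnerSet {G : Type*} [Group G] (K : Finset G) (ε : ℝ) (F : Finset G) : Prop :=
  F.Nonempty ∧ ∀ g ∈ K, (((g • F) ∆ F).card : ℝ) ≤ ε * F.card

/-- Amenability of the discrete group `G` (Følner's condition). -/
def IsAmenable : Prop :=
  ∀ (K : Finset G) (ε : ℝ), 0 < ε → ∃ F : Finset G, IsFoelnerSet K ε F

/-- The filter on finite subsets of `G` of increasing invariance. A sequence (or net) `F_i` of
nonempty finite sets is Følner, i.e. `|g F_i ∆ F_i| / |F_i| → 0` for each `g`, exactly when it
tends to this filter. -/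
def foelnerFilter : Filter (Finset G) :=
  ⨅ (K : Finset G) (ε : ℝ) (_ : 0 < ε), 𝓟 {F | IsFoelnerSet K ε F}

end Amenable

section Entropy

/-- Shannon entropy `H(P) = -∑ᵢ μ(P = i) log μ(P = i)` of the finite partition `{P = i}`. -/
def entropy {Z : Type*} [MeasurableSpace Z] (μ : Measure Z) {ι : Type*} [Fintype ι] (P : Z → ι) : ℝ :=
  ∑ i, Real.negMulLog (μ.real (P ⁻¹' {i}))

/-- Conditional entropy `H(P | 𝒜) = -∫ ∑ᵢ μ(P = i | 𝒜) log μ(P = i | 𝒜) dμ` of the finite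
partition `{P = i}` given the sub-σ-algebra `𝒜`. -/
def condEntropy {Z : Type*} (𝒜 : MeasurableSpace Z) [mZ : MeasurableSpace Z] (μ : Measure Z)
    {ι : Type*} [Fintype ι] (P : Z → ι) : ℝ :=
  ∫ z, ∑ i, Real.negMulLog ((μ[(P ⁻¹' {i}).indicator (fun _ => (1 : ℝ)) | 𝒜]) z) ∂μ

/-- The labelling of the join `⋁_{g ∈ F} T_g⁻¹ P`: a point goes to its `P`-name along `F`. -/
def name {G Z : Type*} [Group G] [MulAction G Z] {ι : Type*} (P : Z → ι) (F : Finset G) (z : Z) :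
    F → ι :=
  fun g => P ((g : G) • z)

open scoped Classical in
/-- Entropy `h(T, P) = lim_F H(⋁_{g ∈ F} T_g⁻¹ P) / |F|` of the process `(T, P)`, the limit being
taken along Følner sets `F`. For amenable `G` the limit exists, so it is written as a `limsup`. -/
def processEntropy (G : Type*) [Group G] {Z : Type*} [MulAction G Z] [MeasurableSpace Z]
    (μ : Measure Z) {k : ℕ} (P : Z → Fin k) : ℝ :=
  limsup (fun F : Finset G => entropy μ (name P F) / F.card) (foelnerFilter G)

open scoped Classical in
/-- Conditional entropy `h(T, P | 𝒜) = lim_F H(⋁_{g ∈ F} T_g⁻¹ P | 𝒜) / |F|` of the process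
`(T, P)` given an invariant sub-σ-algebra `𝒜`, the limit being taken along Følner sets `F`. -/
def condProcessEntropy (G : Type*) [Group G] {Z : Type*} [MulAction G Z]
    (𝒜 : MeasurableSpace Z) [mZ : MeasurableSpace Z] (μ : Measure Z) {k : ℕ} (P : Z → Fin k) : ℝ :=
  limsup (fun F : Finset G => condEntropy 𝒜 μ (name P F) / F.card) (foelnerFilter G)

/-- The action of `G` on `(Z, μ)` has completely positive entropy: `h(T, P) > 0` for every finite
measurable partition `P` that is not trivial modulo `μ`. -/
def IsCPE (G : Type*) [Group G] {Z : Type*} [MulAction G Z] [MeasurableSpace Z]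
    (μ : Measure Z) : Prop :=
  ∀ (k : ℕ) (P : Z → Fin k), Measurable P →
    (¬ ∃ i, ∀ᵐ z ∂μ, P z = i) → 0 < processEntropy G μ P

/-- The action of `G` on `(Z, μ)` has completely positive entropy relative to the invariant
sub-σ-algebra `𝒜`: `h(T, P | 𝒜) > 0` for every finite measurable partition `P` that is not
`𝒜`-measurable modulo `μ`. -/
def IsRelCPE (G : Type*) [Group G] {Z : Type*} [MulAction G Z]
    (𝒜 : MeasurableSpace Z) [mZ : MeasurableSpace Z] (μ : Measure Z) : Prop :=
  ∀ (k : ℕ) (P : Z → Fin k), Measurable[mZ] P →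
    (¬ ∃ Q : Z → Fin k, Measurable[𝒜] Q ∧ P =ᵐ[μ] Q) → 0 < condProcessEntropy G 𝒜 μ P

/-- The action of `G` on `(Z, μ)` is Bernoulli: it is isomorphic modulo null sets, through `φ`, to
the shift action `(g · ω)(h) = ω (h g)` on a product space `(K, κ)^G`. The last clause says that
`φ` induces an isomorphism of measure algebras; between Lebesgue spaces this means that `φ` is
invertible modulo null sets. -/
def IsBernoulli (G : Type*) [Group G] {Z : Type*} [MulAction G Z] [MeasurableSpace Z]
    (μ : Measure Z) : Prop :=
  ∃ (K : Type) (_ : MeasurableSpace K) (_ : StandardBorelSpace K) (κ : Measure K)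
    (_ : IsProbabilityMeasure κ) (φ : Z → G → K),
    MeasurePreserving φ μ (Measure.infinitePi fun _ : G => κ) ∧
    (∀ g : G, ∀ᵐ z ∂μ, φ (g • z) = fun h => φ z (h * g)) ∧
    ∀ s : Set Z, MeasurableSet s → ∃ t : Set (G → K), MeasurableSet t ∧ s =ᵐ[μ] φ ⁻¹' t

end Entropy

end AmenableEntropy

end

/-!
The projection of `X × Y` to `X` is independent of the σ-algebra `𝒜` generated by the projection
to `Y`. Hence for a finite partition `P` of `X` the conditional law given `𝒜` of any name of the
lifted partition `P ∘ Prod.fst` is constant and equal to the law of the same name of `P`, so that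
`H(⋁_{g ∈ F} T_g⁻¹ P) = H(⋁_{g ∈ F} (T × B)_g⁻¹ (P ∘ Prod.fst) | 𝒜)` for every finite `F`, and
`h(T, P) = h(T × B, P ∘ Prod.fst | 𝒜)` (`condProcessEntropy_comp_fst`).
By Fubini, a function of `x` that agrees almost everywhere with a function of `y` is almost
everywhere constant (`exists_ae_eq_const_of_comp_fst_ae_eq`): if `P` is nontrivial, `P ∘ Prod.fst`
is not `𝒜`-measurable modulo null sets, and relative complete positivity applies to it.
-/

open MeasureTheory Filter ProbabilityTheory

namespace AmenableEntropy

variable {X Y : Type*} [MeasurableSpace X] [MeasurableSpace Y]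
  (μ : Measure X) [IsProbabilityMeasure μ] (ν : Measure Y) [IsProbabilityMeasure ν]

/-- Since the two coordinates are independent, conditioning an event of the first coordinate on
the second one does not change its probability. -/
theorem condExp_indicator_fst_preimage {s : Set X} (hs : MeasurableSet s) :
    (μ.prod ν)[(Prod.fst ⁻¹' s).indicator (fun _ => (1 : ℝ)) |
      MeasurableSpace.comap (Prod.snd : X × Y → Y) inferInstance]
      =ᵐ[μ.prod ν] fun _ => μ.real s := by
  have hindep : Indep (MeasurableSpace.comap (Prod.fst : X × Y → X) inferInstance)
      (MeasurableSpace.comap (Prod.snd : X × Y → Y) inferInstance) (μ.prod ν) :=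
    (indepFun_prod (X := id) (Y := id) measurable_id measurable_id : IndepFun _ _ _)
  have hsm : StronglyMeasurable[MeasurableSpace.comap (Prod.fst : X × Y → X) inferInstance]
      ((Prod.fst ⁻¹' s : Set (X × Y)).indicator (fun _ => (1 : ℝ))) :=
    stronglyMeasurable_const.indicator ⟨s, hs, rfl⟩
  refine (condExp_indep_eq measurable_fst.comap_le measurable_snd.comap_le hsm hindep).trans ?_
  refine Eventually.of_forall fun _ => ?_
  simp only
  rw [integral_indicator_const _ (measurable_fst hs), smul_eq_mul, mul_one,
    measurePreserving_fst.measureReal_preimage hs.nullMeasurableSet]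

theorem condEntropy_comp_fst {ι : Type*} [Fintype ι] [MeasurableSpace ι]
    [MeasurableSingletonClass ι] {P : X → ι} (hP : Measurable P) :
    condEntropy (MeasurableSpace.comap (Prod.snd : X × Y → Y) inferInstance) (μ.prod ν)
      (P ∘ Prod.fst) = entropy μ P := by
  have h : ∀ᵐ z ∂μ.prod ν, ∀ i, ((μ.prod ν)[((P ∘ Prod.fst) ⁻¹' {i}).indicator
      (fun _ => (1 : ℝ)) | MeasurableSpace.comap (Prod.snd : X × Y → Y) inferInstance]) z
      = μ.real (P ⁻¹' {i}) :=
    ae_all_iff.2 fun i => condExp_indicator_fst_preimage μ ν (hP (measurableSet_singleton i))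
  rw [condEntropy, integral_congr_ae (g := fun _ => entropy μ P)]
  · simp
  · filter_upwards [h] with z hz
    simp only [hz, entropy]

theorem measurable_name {G : Type*} [Group G] [MulAction G X] [MeasurableConstSMul G X]
    {ι : Type*} [MeasurableSpace ι] {P : X → ι} (hP : Measurable P) (F : Finset G) :
    Measurable (name P F) :=
  measurable_pi_lambda _ fun g => hP.comp (measurable_const_smul (g : G))

open scoped Classical in
theorem condProcessEntropy_comp_fst {G : Type*} [Group G]
    [MulAction G X] [MeasurableConstSMul G X] [MulAction G Y]
    {k : ℕ} {P : X → Fin k} (hP : Measurable P) :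
    condProcessEntropy G (MeasurableSpace.comap (Prod.snd : X × Y → Y) inferInstance) (μ.prod ν)
      (P ∘ Prod.fst) = processEntropy G μ P := by
  unfold condProcessEntropy processEntropy
  congr 1 with F
  congr 1
  exact condEntropy_comp_fst μ ν (measurable_name hP F)

variable {μ ν} in
theorem exists_ae_eq_const_of_comp_fst_ae_eq {ι : Type*} [MeasurableSpace ι]
    [MeasurableSingletonClass ι] {P : X → ι} {Q : X × Y → ι}
    (hQ : Measurable[MeasurableSpace.comap (Prod.snd : X × Y → Y) inferInstance] Q)
    (h : P ∘ Prod.fst =ᵐ[μ.prod ν] Q) : ∃ i, ∀ᵐ x ∂μ, P x = i := by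
  -- Fibres of `Q` are preimages of subsets of `Y`, so `Q` does not depend on `x`.
  have hfac : ∀ x x' y, Q (x, y) = Q (x', y) := by
    intro x x' y
    obtain ⟨t, -, ht⟩ := hQ (measurableSet_singleton (Q (x', y)))
    have hmem : (x', y) ∈ Q ⁻¹' {Q (x', y)} := rfl
    rw [← ht] at hmem
    have hmem' : (x, y) ∈ Prod.snd ⁻¹' t := hmem
    rwa [ht] at hmem'
  have hae := Measure.ae_ae_of_ae_prod h
  obtain ⟨x₀, hx₀⟩ := hae.exists
  refine ⟨P x₀, ?_⟩
  filter_upwards [hae] with x hx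
  -- Almost every `y` serves both `x` and `x₀`, so one such `y` exists.
  obtain ⟨y, hy, hy₀⟩ := (hx.and hx₀).exists
  exact hy.trans ((hfac x x₀ y).trans hy₀.symm)

end AmenableEntropy

theorem mainTheorem5 {G : Type*} [Group G] (hG : AmenableEntropy.IsAmenable G)
    {X : Type*} [MeasurableSpace X] (μ : Measure X) [IsProbabilityMeasure μ]
    [MulAction G X] [MeasurableConstSMul G X] [SMulInvariantMeasure G X μ]
    {Y : Type*} [MeasurableSpace Y] (ν : Measure Y) [IsProbabilityMeasure ν]
    [MulAction G Y] [MeasurableConstSMul G Y] [SMulInvariantMeasure G Y ν]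
    (hB : AmenableEntropy.IsBernoulli G ν)
    (hrel : AmenableEntropy.IsRelCPE G
      (MeasurableSpace.comap (Prod.snd : X × Y → Y) inferInstance) (μ.prod ν)) :
    AmenableEntropy.IsCPE G μ := by
  intro k P hP hnontriv
  rw [← AmenableEntropy.condProcessEntropy_comp_fst μ ν hP]
  refine hrel k _ (hP.comp measurable_fst) fun ⟨Q, hQ, hPQ⟩ => hnontriv ?_
  exact AmenableEntropy.exists_ae_eq_const_of_comp_fst_ae_eq hQ hPQ
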